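/- Setting. Let $\mathbf V$ be a finite set of observed variables with finite domains. A causal diagram is a graph over $\mathbf V$ with directed edges $X\to Y$ and bi-directed edges $X\leftrightarrow Y$ (both may join the same pair) without directed cycles. Two causal diagrams or MAGs are Markov equivalent (ME) if they entail the same $d$-separations. A MAG (maximal ancestral graph) is such a graph without directed or almost directed cycles in which any two distinct nonadjacent nodes can be $d$-separated; it represents the causal diagrams with the same $d$-separations and the same ancestral relations. A PAG $\mathcal P$ summarizes a Markov equivalence class (adjacencies, the edge marks shared by all ME MAGs, and circles for the marks that differ among them). A loyal equivalent graph (LEG) of a MAG $\mathcal G$ is an ME MAG that contains every directed edge of $\mathcal G$ and whose bi-directed edges are all invariant, i.e. present in every ME MAG. A causal diagram is maximally bi-directed (MBD) if no further bi-directed edges can be added without breaking a $d$-separation. A (recursive) structural causal model (SCM) $\mathcal M$ consists of exogenous variables $\mathbf U$ with a distribution $P(\mathbf U)$ and functions $V\leftarrow f_V(\mathbf{Pa}_V,\mathbf U_V)$, $V\in\mathbf V$. Its induced diagram has $V\to W$ iff $V\in\mathbf{Pa}_W$, and $V\leftrightarrow W$ iff $V \neq W$ and $\mathbf U_V\cap\mathbf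 U_W\neq\emptyset$. $\mathcal M$ is compatible with a diagram $\mathcal G$ if its induced diagram is a subgraph of $\mathcal G$ (edges permit, and missing edges forbid, arguments and shared exogenous variables). For a set $\mathcal K$ of diagrams let $\mathbb M(\mathcal K)$ be the set of SCMs compatible with some $\mathcal G\in\mathcal K$. Let $\mathbb M(\mathcal P)$ be $\mathbb M$ of the set of all causal diagrams in the class of $\mathcal P$, and, for an LEG $L$, let $\mathbb M(L)$ be $\mathbb M$ of the set of all causal diagrams represented by $L$. Let $P_{\mathbf x}(\mathbf y;\mathcal M)$ denote the probability of $\mathbf Y=\mathbf y$ in $\mathcal M$ under the intervention $do(\mathbf X=\mathbf x)$. Proposition (Expressiveness of MBD diagrams). Let $\mathcal P$ be a PAG over $\mathbf V$ and let $\mathcal D$ be the set of MBD causal diagrams in the class of $\mathcal P$. 1. $\mathbb M(\mathcal P)=\mathbb M(\mathcal D)$. 2. The SCMs whose induced diagram is itself in the class of $\mathcal P$, and those whose induced diagram is itself in $\mathcal D$, have the same systems of causal effects $(\mathbf X,\mathbf x,\mathbf Y,\mathbf y)\mapsto P_{\mathbf x}(\mathbf y;\mathcal M)$. This holds for arbitrary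 $P(\mathbf U)$, and also if only SCMs with mutually independent exogenous variables are considered. 3. Let $L$ be an LEG in the class of $\mathcal P$ and let $\mathbb G_L$ be the set of MBD causal diagrams represented by $L$. Then $\mathbb M(L)=\mathbb M(\mathbb G_L)$. Moreover, every causal diagram $\mathcal G$ represented by $L$ is subsumed by an MBD diagram: there is $\mathcal H\in\mathbb G_L\cap\mathcal D$ such that $\mathcal G$ is a subgraph of $\mathcal H$ and $\mathbb M(\{\mathcal G\})\subseteq\mathbb M(\{\mathcal H\})$. -/

import Mathlib

open MeasureTheory Set

universe u v w

/-! ## Mixed graphs, paths and d-separation -/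

/-- A mixed graph on `V`: directed edges `X → Y` and bi-directed edges `X ↔ Y`.  Two nodes may be
joined by a directed and a bi-directed edge at the same time. -/
@[ext]
structure MixedGraph (V : Type u) where
  dir : V → V → Prop
  bi : V → V → Prop
  bi_symm : ∀ X Y, bi X Y → bi Y X
  bi_irrefl : ∀ X, ¬ bi X X

/-- The kind of an edge that is traversed from `X` to `Y`: `X → Y`, `X ← Y` or `X ↔ Y`. -/
inductive EdgeKind
  | fwd
  | bwd
  | bidir

/-- The traversed edge `X * Y` has an arrowhead at its starting point `X`. -/
def EdgeKind.headAtSource : EdgeKind → Prop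
  | .fwd => False
  | .bwd => True
  | .bidir => True

/-- The traversed edge `X * Y` has an arrowhead at its end point `Y`. -/
def EdgeKind.headAtTarget : EdgeKind → Prop
  | .fwd => True
  | .bwd => False
  | .bidir => True

namespace MixedGraph

variable {V : Type u}

/-- There is an edge of kind `k` when going from `X` to `Y`. -/
def HasEdge (G : MixedGraph V) : EdgeKind → V → V → Prop
  | .fwd, X, Y => G.dir X Y
  | .bwd, X, Y => G.dir Y X
  | .bidir, X, Y => G.bi X Y

/-- Adjacency: some edge joins `X` and `Y`. -/
def Adj (G : MixedGraph V) (X Y : V) : Prop :=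
  G.dir X Y ∨ G.dir Y X ∨ G.bi X Y

/-- Some edge between `X` and `Y` has an arrowhead at `Y`. -/
def HeadAt (G : MixedGraph V) (X Y : V) : Prop :=
  G.dir X Y ∨ G.bi X Y

/-- `X` is an ancestor of `Y` (every node is an ancestor of itself). -/
def Anc (G : MixedGraph V) (X Y : V) : Prop :=
  Relation.ReflTransGen G.dir X Y

/-- No directed cycles. -/
def Acyclic (G : MixedGraph V) : Prop :=
  ∀ X, ¬ Relation.TransGen G.dir X X

/-- A path: a sequence of distinct nodes together with, for each pair of consecutive nodes, an edge
of the graph that joins them. -/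
structure GPath (G : MixedGraph V) (X Y : V) where
  len : ℕ
  node : Fin (len + 1) → V
  edge : Fin len → EdgeKind
  node_inj : Function.Injective node
  first : node 0 = X
  last : node (Fin.last len) = Y
  valid : ∀ i : Fin len, G.HasEdge (edge i) (node i.castSucc) (node i.succ)

/-- A path is open given `Z` if every non-endpoint node on it that is a collider has a descendant
(possibly itself) in `Z`, and every non-endpoint node on it that is not a collider lies outside `Z`.
The non-endpoint nodes are the common ends of the consecutive edges number `i` and `j = i + 1`. -/
def GPath.Open {G : MixedGraph V} {X Y : V} (p : G.GPath X Y) (Z : Set V) : Prop :=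
  ∀ i j : Fin p.len, (i : ℕ) + 1 = (j : ℕ) →
    (((p.edge i).headAtTarget ∧ (p.edge j).headAtSource) →
        ∃ z ∈ Z, G.Anc (p.node j.castSucc) z) ∧
    (¬ ((p.edge i).headAtTarget ∧ (p.edge j).headAtSource) → p.node j.castSucc ∉ Z)

/-- d-separation (called m-separation in the case of ancestral graphs) of the sets `A` and `B`
given `Z`: every path between a node of `A` and a node of `B` is blocked by `Z`. -/
def DSep (G : MixedGraph V) (A B Z : Set V) : Prop :=
  ∀ X ∈ A, ∀ Y ∈ B, ∀ p : G.GPath X Y, ¬ p.Open Z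

/-- Markov equivalence: the same d-separations between pairwise disjoint sets of nodes. -/
def MarkovEquiv (G H : MixedGraph V) : Prop :=
  ∀ A B Z : Set V, Disjoint A B → Disjoint A Z → Disjoint B Z →
    (G.DSep A B Z ↔ H.DSep A B Z)

/-- `G` is a subgraph of `H` (on the same nodes). -/
def Subgraph (G H : MixedGraph V) : Prop :=
  (∀ X Y, G.dir X Y → H.dir X Y) ∧ (∀ X Y, G.bi X Y → H.bi X Y)

end MixedGraph

/-! ## Causal diagrams, MAGs, LEGs, PAGs -/

/-- A causal diagram: a mixed graph without directed cycles. -/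
@[ext]
structure CausalDiagram (V : Type u) extends MixedGraph V where
  acyclic : toMixedGraph.Acyclic

/-- A maximal ancestral graph (without selection bias): no directed cycle, no almost directed cycle
and for any two distinct nonadjacent nodes a set of other nodes that separates them. -/
@[ext]
structure MAG (V : Type u) extends MixedGraph V where
  acyclic : toMixedGraph.Acyclic
  no_almost_cycle : ∀ X Y, toMixedGraph.Anc X Y → ¬ bi X Y
  maximal : ∀ X Y, X ≠ Y → ¬ toMixedGraph.Adj X Y →
    ∃ Z : Set V, X ∉ Z ∧ Y ∉ Z ∧ toMixedGraph.DSep {X} {Y} Z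

/-- A causal diagram is maximally bi-directed if adding any (non-empty) collection of bi-directed
edges to it breaks a d-separation. -/
def CausalDiagram.IsMBD {V : Type u} (G : CausalDiagram V) : Prop :=
  ∀ H : CausalDiagram V, H.dir = G.dir → (∀ X Y, G.bi X Y → H.bi X Y) → H.bi ≠ G.bi →
    ∃ A B Z : Set V, Disjoint A B ∧ Disjoint A Z ∧ Disjoint B Z ∧
      G.DSep A B Z ∧ ¬ H.DSep A B Z

namespace MAG

variable {V : Type u}

/-- The causal diagrams represented by a MAG: those with the same d-separations and the same
ancestral relations. -/
def diagrams (M : MAG V) : Set (CausalDiagram V) :=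
  {G | G.MarkovEquiv M.toMixedGraph ∧ ∀ X Y, G.Anc X Y ↔ M.Anc X Y}

/-- `H` is a loyal equivalent graph of the MAG `M`. -/
def IsLEGOf (H M : MAG V) : Prop :=
  H.MarkovEquiv M.toMixedGraph ∧
  (∀ X Y, H.bi X Y → ∀ K : MAG V, K.MarkovEquiv M.toMixedGraph → K.bi X Y) ∧
  (∀ X Y, M.dir X Y → H.dir X Y)

/-- `H` is a loyal equivalent graph (of some MAG). -/
def IsLEG (H : MAG V) : Prop := ∃ M : MAG V, H.IsLEGOf M

end MAG

/-- Edge marks of a PAG. -/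
inductive Mark
  | tail
  | head
  | circle

/-- `mark` (with `mark X Y` the mark at `Y` of the edge between `X` and `Y`, or `none` if they are
not adjacent) is the PAG of the Markov equivalence class of the MAG `M`: it has the adjacencies of
`M`, the arrowheads and tails are those shared by all members of the class, and a circle stands
for a mark that differs between members of the class. -/
def IsPAGOf {V : Type u} (mark : V → V → Option Mark) (M : MAG V) : Prop :=
  ∀ X Y,
    (mark X Y = none ↔ ¬ M.Adj X Y) ∧
    (mark X Y = some .head ↔
      M.Adj X Y ∧ ∀ H : MAG V, H.MarkovEquiv M.toMixedGraph → H.HeadAt X Y) ∧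
    (mark X Y = some .tail ↔
      M.Adj X Y ∧ ∀ H : MAG V, H.MarkovEquiv M.toMixedGraph → H.dir Y X) ∧
    (mark X Y = some .circle ↔
      (∃ H : MAG V, H.MarkovEquiv M.toMixedGraph ∧ H.HeadAt X Y) ∧
      (∃ H : MAG V, H.MarkovEquiv M.toMixedGraph ∧ H.dir Y X))

/-- A partial ancestral graph: the summary of a Markov equivalence class of MAGs. -/
structure PAG (V : Type u) where
  mark : V → V → Option Mark
  exists_mag : ∃ M : MAG V, IsPAGOf mark M

namespace PAG

variable {V : Type u}

/-- The causal diagrams in the Markov equivalence class summarized by a PAG. -/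
def diagrams (P : PAG V) : Set (CausalDiagram V) :=
  {G | ∃ M : MAG V, IsPAGOf P.mark M ∧ G.MarkovEquiv M.toMixedGraph}

/-- The maximally bi-directed causal diagrams in the class. -/
def mbdDiagrams (P : PAG V) : Set (CausalDiagram V) :=
  {G | G ∈ P.diagrams ∧ G.IsMBD}

/-- The loyal equivalent graphs in the class. -/
def legs (P : PAG V) : Set (MAG V) :=
  {L | IsPAGOf P.mark L ∧ L.IsLEG}

end PAG

/-! ## Structural causal models -/

/-- A recursive structural causal model with endogenous variables `V`, where the variable `X` takes
values in `Ω X`: the exogenous variables `U` have arbitrary measurable domains and an arbitrary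
joint distribution `prob`, and `X` is determined by the function `f X` of the endogenous variables in
`pa X` and the exogenous variables in `ex X`. -/
structure SCM {V : Type u} (Ω : V → Type v) where
  U : Type w
  dom : U → Type w
  [meas : ∀ i, MeasurableSpace (dom i)]
  prob : Measure (∀ i, dom i)
  [isProb : IsProbabilityMeasure prob]
  pa : V → Set V
  ex : V → Set U
  f : ∀ X : V, (∀ Y : pa X, Ω Y) → (∀ i : ex X, dom i) → Ω X
  measurable_f : ∀ X a y, MeasurableSet {e | f X a e = y}
  recursive : ∀ X, ¬ Relation.TransGen (fun A B => A ∈ pa B) X X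

attribute [instance] SCM.meas SCM.isProb

namespace SCM

variable {V : Type u} {Ω : V → Type v}

/-- The induced causal diagram: `X → Y` if `X` is an argument of the function of `Y`, and `X ↔ Y` if
the functions of `X` and `Y` share an exogenous argument. -/
def diagram (M : SCM.{u, v, w} Ω) : CausalDiagram V where
  dir X Y := X ∈ M.pa Y
  bi X Y := X ≠ Y ∧ (M.ex X ∩ M.ex Y).Nonempty
  bi_symm X Y h := ⟨h.1.symm, by rw [Set.inter_comm]; exact h.2⟩
  bi_irrefl X h := h.1 rfl
  acyclic := M.recursive

/-- `M` is compatible with the diagram `G`: an edge of `G` permits, and a missing edge forbids, the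
corresponding argument or the corresponding shared exogenous argument. -/
def Compatible (M : SCM.{u, v, w} Ω) (G : CausalDiagram V) : Prop :=
  M.diagram.Subgraph G.toMixedGraph

/-- The exogenous variables are mutually independent. -/
def IndepExogenous (M : SCM.{u, v, w} Ω) : Prop :=
  ProbabilityTheory.iIndepFun (fun (i : M.U) (e : ∀ j, M.dom j) => e i) M.prob

/-- In the submodel for the intervention that sets the variables in `A` to their values in `a`, the
values `s` of the endogenous variables solve the equations for the exogenous values `e`. -/
def Solves (M : SCM.{u, v, w} Ω) (A : Set V) (a : ∀ X, Ω X) (e : ∀ i, M.dom i)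
    (s : ∀ X, Ω X) : Prop :=
  (∀ X ∈ A, s X = a X) ∧ (∀ X, X ∉ A → s X = M.f X (fun Y => s Y) (fun i => e i))

/-- The causal effect `P_a(b)`: the probability that the variables in `B` take their values in `b`
under the intervention that sets the variables in `A` to their values in `a`. -/
noncomputable def effect (M : SCM.{u, v, w} Ω) (A : Set V) (a : ∀ X, Ω X) (B : Set V)
    (b : ∀ X, Ω X) : ENNReal :=
  M.prob {e | ∃ s, M.Solves A a e s ∧ ∀ X ∈ B, s X = b X}

end SCM

/-- The SCMs compatible with a set of causal diagrams, that is, with one of its members. -/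
def compatibleSCMs {V : Type u} (Ω : V → Type v) (K : Set (CausalDiagram V)) :
    Set (SCM.{u, v, w} Ω) :=
  {M | ∃ G ∈ K, M.Compatible G}

/-- The systems of causal effects of the SCMs from the class `S` whose induced causal diagram is in
the set `K`. -/
def inducedEffects {V : Type u} {Ω : V → Type v} (S : Set (SCM.{u, v, w} Ω))
    (K : Set (CausalDiagram V)) :
    Set (Set V → (∀ X, Ω X) → Set V → (∀ X, Ω X) → ENNReal) :=
  {q | ∃ M ∈ S, M.diagram ∈ K ∧ M.effect = q}

/-! ## Adding bi-directed edges to a causal diagram -/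

/-! Compatibility only asks the induced diagram to be a subgraph, so it is monotone in the diagram.
The equalities of compatible models therefore reduce to embedding each diagram `G` in a Markov
equivalent MBD one. As `V` is finite, a largest admissible set of bi-directed edges exists
(`exists_isMBD_supergraph`); extra edges never create a separation, so an enlargement that breaks
none would contradict maximality. The directed edges stay fixed, hence so do the ancestral
relations, and the extension is represented by the same MAG.

For causal effects, the induced diagram has to equal the MBD diagram. The missing bi-directed edges
are realized by shared one-valued exogenous variables that the functions ignore; these alter neither
effects nor independence (`SCM.exists_diagram_eq`). -/

namespace MixedGraph

variable {V : Type u}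

/-- A path of `G` as a path of a supergraph `H`. -/
def GPath.ofSubgraph {G H : MixedGraph V} (h : G.Subgraph H) {X Y : V} (p : G.GPath X Y) :
    H.GPath X Y where
  len := p.len
  node := p.node
  edge := p.edge
  node_inj := p.node_inj
  first := p.first
  last := p.last
  valid i := by
    have hv := p.valid i
    cases hk : p.edge i <;> rw [hk] at hv
    · exact h.1 _ _ hv
    · exact h.1 _ _ hv
    · exact h.2 _ _ hv

/-- Passing to a supergraph with more edges can only destroy d-separations. -/
theorem DSep.of_subgraph {G H : MixedGraph V} (h : G.Subgraph H) {A B Z : Set V}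
    (hs : H.DSep A B Z) : G.DSep A B Z := by
  intro X hX Y hY p hp
  refine hs X hX Y hY (p.ofSubgraph h) fun i j hij => ⟨fun hc => ?_, (hp i j hij).2⟩
  -- Only the collider condition refers to the ambient graph, and ancestors in `G` remain ancestors
  -- in `H`.
  obtain ⟨z, hz, ha⟩ := (hp i j hij).1 hc
  exact ⟨z, hz, Relation.ReflTransGen.mono h.1 _ _ ha⟩

theorem MarkovEquiv.trans {G H K : MixedGraph V} (h₁ : G.MarkovEquiv H) (h₂ : H.MarkovEquiv K) :
    G.MarkovEquiv K :=
  fun A B Z h h' h'' => (h₁ A B Z h h' h'').trans (h₂ A B Z h h' h'')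

end MixedGraph

namespace CausalDiagram

variable {V : Type u}

/-- Every causal diagram extends, by adding bi-directed edges only, to a Markov equivalent one that
is maximally bi-directed. -/
theorem exists_isMBD_supergraph [Finite V] (G : CausalDiagram V) :
    ∃ H : CausalDiagram V, H.dir = G.dir ∧ G.Subgraph H.toMixedGraph ∧
      H.MarkovEquiv G.toMixedGraph ∧ H.IsMBD := by
  obtain ⟨r, ⟨H, hdir, hbi, hme, rfl⟩, hmax⟩ := Set.Finite.exists_maximal
    (s := {r : V → V → Prop | ∃ H : CausalDiagram V, H.dir = G.dir ∧
      (∀ X Y, G.bi X Y → H.bi X Y) ∧ H.MarkovEquiv G.toMixedGraph ∧ H.bi = r})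
    (Set.toFinite _) ⟨G.bi, G, rfl, fun _ _ => id, fun _ _ _ _ _ _ => Iff.rfl, rfl⟩
  refine ⟨H, hdir, ⟨fun X Y h => hdir ▸ h, hbi⟩, hme, fun K hK hle hne => ?_⟩
  by_contra! hsep
  -- If `K` breaks no separation, it is itself a candidate, so maximality of `H.bi` forces `K.bi =
  -- H.bi`.
  refine hne (le_antisymm (hmax ⟨K, hK.trans hdir, fun X Y h => hle X Y (hbi X Y h), ?_, rfl⟩ hle)
    hle)
  refine MixedGraph.MarkovEquiv.trans (fun A B Z h h' h'' => ⟨fun hs => ?_, ?_⟩) hme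
  · exact hs.of_subgraph ⟨fun X Y h => hK ▸ h, hle⟩
  · exact hsep A B Z h h' h''

end CausalDiagram

theorem PAG.exists_mem_mbdDiagrams {V : Type u} [Finite V] (P : PAG V) {G : CausalDiagram V}
    (hG : G ∈ P.diagrams) :
    ∃ H ∈ P.mbdDiagrams, H.dir = G.dir ∧ G.Subgraph H.toMixedGraph := by
  obtain ⟨M, hM, hGM⟩ := hG
  obtain ⟨H, hdir, hsub, hme, hmbd⟩ := G.exists_isMBD_supergraph
  exact ⟨H, ⟨⟨M, hM, hme.trans hGM⟩, hmbd⟩, hdir, hsub⟩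

theorem MAG.exists_isMBD_mem_diagrams {V : Type u} [Finite V] (L : MAG V) {G : CausalDiagram V}
    (hG : G ∈ L.diagrams) :
    ∃ H ∈ L.diagrams, H.IsMBD ∧ G.Subgraph H.toMixedGraph := by
  obtain ⟨H, hdir, hsub, hme, hmbd⟩ := G.exists_isMBD_supergraph
  refine ⟨H, ⟨hme.trans hG.1, fun X Y => ?_⟩, hmbd, hsub⟩
  rw [← hG.2, MixedGraph.Anc, MixedGraph.Anc, hdir]

/-! ## Adding unused exogenous arguments to a structural causal model -/

namespace SCM

variable {V : Type u} {Ω : V → Type v}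

theorem Compatible.mono {M : SCM.{u, v, w} Ω} {G H : CausalDiagram V} (hM : M.Compatible G)
    (h : G.Subgraph H.toMixedGraph) : M.Compatible H :=
  ⟨fun X Y hXY => h.1 X Y (hM.1 X Y hXY), fun X Y hXY => h.2 X Y (hM.2 X Y hXY)⟩

section Extend

variable (M : SCM.{u, v, w} Ω) (J : Type w)

/-- The domains of the exogenous variables of `M` and of further ones, indexed by `J`, that have only
one value. -/
def extendDom : M.U ⊕ J → Type w :=
  Sum.elim M.dom fun _ => PUnit

instance extendDomMeasurableSpace : ∀ i, MeasurableSpace (M.extendDom J i)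
  | .inl i => M.meas i
  | .inr _ => (⊤ : MeasurableSpace PUnit)

/-- Extending the exogenous values by those of the one-valued variables. -/
def extendExo : (∀ i, M.dom i) ≃ᵐ (∀ i, M.extendDom J i) where
  toFun e
    | .inl i => e i
    | .inr _ => PUnit.unit
  invFun e i := e (.inl i)
  left_inv _ := rfl
  right_inv e := by
    funext i
    cases i <;> rfl
  measurable_toFun := by
    refine measurable_pi_lambda _ fun i => ?_
    cases i with
    | inl i => exact measurable_pi_apply i
    | inr j => exact measurable_const
  measurable_invFun := measurable_pi_lambda _ fun i =>
    measurable_pi_apply (X := M.extendDom J) (Sum.inl i)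

/-- The model in which the function of `X` receives the additional one-valued exogenous arguments
`j` with `T j X`, which it ignores. -/
noncomputable def extend (T : J → V → Prop) : SCM.{u, v, w} Ω where
  U := M.U ⊕ J
  dom := M.extendDom J
  meas := M.extendDomMeasurableSpace J
  prob := M.prob.map (M.extendExo J)
  isProb := Measure.isProbabilityMeasure_map (M.extendExo J).measurable.aemeasurable
  pa := M.pa
  ex X := {i | Sum.elim (· ∈ M.ex X) (T · X) i}
  f X a e := M.f X a fun i => e ⟨.inl i, i.2⟩
  measurable_f X a y := by
    refine measurableSet_preimage (f := fun (e : ∀ i : {i | Sum.elim (· ∈ M.ex X) (T · X) i},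
      M.extendDom J i) (i : M.ex X) => (e ⟨.inl i, i.2⟩ : M.dom i)) ?_ (M.measurable_f X a y)
    exact measurable_pi_lambda _ fun i => measurable_pi_apply
      (X := fun i : {i | Sum.elim (· ∈ M.ex X) (T · X) i} => M.extendDom J i) ⟨.inl i, i.2⟩
  recursive := M.recursive

/-- The event of the extended model pulls back to the original one by definition. Since `extendExo`
is a measurable equivalence, `map_apply` needs no measurability of this event. -/
theorem extend_effect (T : J → V → Prop) : (M.extend J T).effect = M.effect := by
  funext A a B b
  exact (M.extendExo J).map_apply _

theorem extend_diagram_bi (T : J → V → Prop) (X Y : V) :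
    (M.extend J T).diagram.bi X Y ↔ M.diagram.bi X Y ∨ X ≠ Y ∧ ∃ j, T j X ∧ T j Y := by
  constructor
  · rintro ⟨hne, i | j, hX, hY⟩
    · exact .inl ⟨hne, i, hX, hY⟩
    · exact .inr ⟨hne, j, hX, hY⟩
  · rintro (⟨hne, i, hX, hY⟩ | ⟨hne, j, hX, hY⟩)
    · exact ⟨hne, .inl i, hX, hY⟩
    · exact ⟨hne, .inr j, hX, hY⟩

theorem iIndepFun_map_extendExo (hM : M.IndepExogenous) :
    ProbabilityTheory.iIndepFun (fun (i : M.U ⊕ J) (e : ∀ j, M.extendDom J j) => e i)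
      (M.prob.map (M.extendExo J)) := by
  have hM' := (ProbabilityTheory.iIndepFun_iff_measure_inter_preimage_eq_mul).1 hM
  refine (ProbabilityTheory.iIndepFun_iff_measure_inter_preimage_eq_mul).2 fun S s hs => ?_
  have key := hM' S.toLeft (sets := fun i => s (.inl i))
    fun i hi => hs (.inl i) (Finset.mem_toLeft.1 hi)
  simp_rw [(M.extendExo J).map_apply]
  -- An event about a one-valued variable is everything or empty. If all those in `S` are
  -- everything, their factors are 1 and the product formula of `M` remains; otherwise both sides
  -- vanish.
  by_cases hne : ∀ j, Sum.inr j ∈ S → PUnit.unit ∈ s (.inr j)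
  · rw [← S.toLeft_disjSum_toRight, Finset.prod_disjSum, Finset.prod_eq_one (s := S.toRight),
      mul_one, S.toLeft_disjSum_toRight]
    · refine Eq.trans (congrArg _ ?_) key
      ext e
      simp only [mem_preimage, mem_iInter, Finset.mem_toLeft]
      refine ⟨fun h i hi => h (.inl i) hi, fun h i hi => ?_⟩
      cases i with
      | inl i => exact h i hi
      | inr j => exact hne j hi
    · intro j hj
      rw [← measure_univ (μ := M.prob)]
      congr 1
      exact eq_univ_of_forall fun e => hne j (Finset.mem_toRight.1 hj)
  · push Not at hne
    obtain ⟨j, hj, hjs⟩ := hne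
    rw [Finset.prod_eq_zero hj]
    · refine measure_mono_null (t := ∅) (fun e he => ?_) measure_empty
      exact hjs (mem_iInter₂.1 he (.inr j) hj)
    · refine measure_mono_null (t := ∅) (fun e he => hjs he) measure_empty

theorem extend_indepExogenous (T : J → V → Prop) (hM : M.IndepExogenous) :
    (M.extend J T).IndepExogenous :=
  M.iIndepFun_map_extendExo J hM

end Extend

/-- Bi-directed edges can be added to the induced diagram without changing the causal effects. -/
theorem exists_diagram_eq [Finite V] (M : SCM.{u, v, w} Ω) {H : CausalDiagram V}
    (hdir : H.dir = M.diagram.dir) (hbi : ∀ X Y, M.diagram.bi X Y → H.bi X Y) :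
    ∃ N : SCM.{u, v, w} Ω, N.diagram = H ∧ N.effect = M.effect ∧
      (M.IndepExogenous → N.IndepExogenous) := by
  obtain ⟨n, ⟨φ⟩⟩ := Finite.exists_equiv_fin V
  -- One dummy variable per ordered pair of nodes, used only by the two ends and only if they are
  -- joined by a bi-directed edge of `H`. Indexing by `Fin n` lets the index type live in universe
  -- `w`.
  let T : ULift.{w} (Fin n × Fin n) → V → Prop := fun j X =>
    H.bi (φ.symm j.down.1) (φ.symm j.down.2) ∧ (X = φ.symm j.down.1 ∨ X = φ.symm j.down.2)
  refine ⟨M.extend _ T, ?_, M.extend_effect _ T, M.extend_indepExogenous _ T⟩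
  ext X Y
  · rw [hdir]
    rfl
  · rw [extend_diagram_bi]
    constructor
    · rintro (h | ⟨hne, j, ⟨hj, hX⟩, -, hY⟩)
      · exact hbi X Y h
      · rcases hX with rfl | rfl <;> rcases hY with rfl | rfl
        · exact absurd rfl hne
        · exact hj
        · exact H.bi_symm _ _ hj
        · exact absurd rfl hne
    · intro h
      refine .inr ⟨fun hXY => H.bi_irrefl Y (hXY ▸ h), ⟨(φ X, φ Y)⟩, ?_, ?_⟩ <;> simp [T, h]

end SCM

/-! ### Comparison of model classes and of causal effects -/

theorem compatibleSCMs_subset_of_forall {V : Type u} (Ω : V → Type v)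
    {K K' : Set (CausalDiagram V)}
    (h : ∀ G ∈ K, ∃ H ∈ K', G.Subgraph H.toMixedGraph) :
    compatibleSCMs.{u, v, w} Ω K ⊆ compatibleSCMs.{u, v, w} Ω K' := by
  rintro M ⟨G, hG, hM⟩
  obtain ⟨H, hH, hsub⟩ := h G hG
  exact ⟨H, hH, hM.mono hsub⟩

theorem compatibleSCMs_mono {V : Type u} (Ω : V → Type v) {K K' : Set (CausalDiagram V)}
    (h : K ⊆ K') : compatibleSCMs.{u, v, w} Ω K ⊆ compatibleSCMs.{u, v, w} Ω K' :=
  fun _ ⟨G, hG, hM⟩ => ⟨G, h hG, hM⟩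

/-- The closure condition `hS` covers both the class of all models and that of models with
independent exogenous variables. -/
theorem inducedEffects_diagrams_eq {V : Type u} [Finite V] {Ω : V → Type v} (P : PAG V)
    {S : Set (SCM.{u, v, w} Ω)}
    (hS : ∀ M ∈ S, ∀ N : SCM.{u, v, w} Ω, (M.IndepExogenous → N.IndepExogenous) → N ∈ S) :
    inducedEffects S P.diagrams = inducedEffects S P.mbdDiagrams := by
  apply Subset.antisymm
  · rintro q ⟨M, hM, hG, rfl⟩
    obtain ⟨H, hH, hdir, hsub⟩ := P.exists_mem_mbdDiagrams hG
    obtain ⟨N, rfl, heff, hind⟩ := M.exists_diagram_eq hdir hsub.2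
    exact ⟨N, hS M hM N hind, hH, heff⟩
  · rintro q ⟨M, hM, hG, rfl⟩
    exact ⟨M, hM, hG.1, rfl⟩

theorem mainTheorem7 {V : Type u} [Finite V] (Ω : V → Type v) [∀ X, Finite (Ω X)] (P : PAG V) :
    compatibleSCMs.{u, v, w} Ω P.diagrams = compatibleSCMs.{u, v, w} Ω P.mbdDiagrams ∧
    (∀ S ∈ ({Set.univ, {M | M.IndepExogenous}} : Set (Set (SCM.{u, v, w} Ω))),
      inducedEffects S P.diagrams = inducedEffects S P.mbdDiagrams) ∧
    ∀ L ∈ P.legs,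
      compatibleSCMs.{u, v, w} Ω L.diagrams =
        compatibleSCMs.{u, v, w} Ω {G | G ∈ L.diagrams ∧ G.IsMBD} ∧
      ∀ G ∈ L.diagrams, ∃ H ∈ L.diagrams, H ∈ P.mbdDiagrams ∧
        G.Subgraph H.toMixedGraph ∧
        compatibleSCMs.{u, v, w} Ω {G} ⊆ compatibleSCMs.{u, v, w} Ω {H} := by
  refine ⟨Subset.antisymm ?_ (compatibleSCMs_mono Ω fun G hG => hG.1), ?_, fun L hL =>
    ⟨Subset.antisymm ?_ (compatibleSCMs_mono Ω fun G hG => hG.1), fun G hG => ?_⟩⟩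
  · refine compatibleSCMs_subset_of_forall Ω fun G hG => ?_
    obtain ⟨H, hH, -, hsub⟩ := P.exists_mem_mbdDiagrams hG
    exact ⟨H, hH, hsub⟩
  · rintro S (rfl | rfl)
    · exact inducedEffects_diagrams_eq P fun _ _ _ _ => mem_univ _
    · exact inducedEffects_diagrams_eq P fun _ hM _ hN => hN hM
  · refine compatibleSCMs_subset_of_forall Ω fun G hG => ?_
    obtain ⟨H, hH, hmbd, hsub⟩ := L.exists_isMBD_mem_diagrams hG
    exact ⟨H, ⟨hH, hmbd⟩, hsub⟩
  · obtain ⟨H, hH, hmbd, hsub⟩ := L.exists_isMBD_mem_diagrams hG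
    -- `L` itself is the MAG witnessing that `H` lies in the class of `P`.
    refine ⟨H, hH, ⟨⟨L, hL.1, hH.1⟩, hmbd⟩, hsub, compatibleSCMs_subset_of_forall Ω ?_⟩
    rintro _ rfl
    exact ⟨H, rfl, hsub⟩
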